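/- Let $dA(z)=\frac1\pi\,dx\,dy$ on $\mathbb C$ and $d\lambda(z)=\frac12 e^{-|z|^2/2}\,dA(z)$. Let $\mathcal F^2$ be the Fock space of all entire functions in $L^2(\mathbb C,d\lambda)$, with the norm of $L^2(\mathbb C,d\lambda)$, and let $K_z(w)=e^{\bar z w/2}$ and $k_z(w)=e^{w\bar z/2-|z|^2/4}$ be its reproducing kernel and its normalized reproducing kernel. Let $r\ge\sqrt{2\pi}$, let $\{a_k\}_{k=1}^\infty$ be an enumeration without repetition of the square lattice $\{mr+\mathrm i\,nr : m,n\in\mathbb Z\}$, and let $\nu=\sum_{k=1}^\infty\delta_{a_k}$, where $\delta_a$ is the unit point mass at $a$. Then: 1. $\nu$ is not a reverse Carleson measure for $\mathcal F^2$: there is no constant $C>0$ such that $\int_{\mathbb C}|f(w)|^2e^{-|w|^2/2}\,d\nu(w)\ge C\int_{\mathbb C}|f(w)|^2e^{-|w|^2/2}\,dA(w)$ for all $f\in\mathcal F^2$. 2. $\nu$ satisfies condition (M): $\int_{\mathbb C}|K_z(w)|^2e^{-|w|^2/2}\,d\nu(w)<\infty$ for all $z\in\mathbb C$. 3. $\nu$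 satisfies the reverse Carleson condition for $\mathcal F^2$: there are $\rho>0$ and $C>0$ such that $C^{-1}\le\nu(B(z,\rho))\le C$ for all $z\in\mathbb C$, where $B(z,\rho)=\{w:|w-z|<\rho\}$. 4. The Berezin transform $\widetilde\nu(z)=\frac12\int_{\mathbb C}|k_z(w)|^2e^{-|w|^2/2}\,d\nu(w)$ is bounded below: there is $\delta>0$ with $\widetilde\nu(z)\ge\delta$ for all $z\in\mathbb C$. 5. The Toeplitz operator $T_\nu f(z)=\frac12\int_{\mathbb C}f(w)\overline{K_z(w)}e^{-|w|^2/2}\,d\nu(w)$ (the integral converging absolutely for all $f\in\mathcal F^2$ and $z\in\mathbb C$) is a bounded linear operator on $\mathcal F^2$, but it is not invertible on $\mathcal F^2$. -/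

import Mathlib

open MeasureTheory ComplexConjugate

noncomputable section

namespace Fock

/-- Normalized area measure `dA = (1/π) dx dy` on `ℂ`. -/
def area : Measure ℂ := ENNReal.ofReal Real.pi⁻¹ • volume

/-- Gaussian measure `dλ(z) = (1/2) exp (-|z|² / 2) dA(z)` on `ℂ`. -/
def gaussian : Measure ℂ :=
  area.withDensity fun z => ENNReal.ofReal (1 / 2 * Real.exp (-‖z‖ ^ 2 / 2))

lemma volume_absolutelyContinuous_gaussian : (volume : Measure ℂ) ≪ gaussian := by
  have h1 : (volume : Measure ℂ) ≪ area := by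
    refine Measure.absolutelyContinuous_smul ?_
    simp [Real.pi_pos]
  refine h1.trans (withDensity_absolutelyContinuous' ?_ ?_)
  · exact (by fun_prop : Measurable fun z : ℂ =>
      ENNReal.ofReal (1 / 2 * Real.exp (-‖z‖ ^ 2 / 2))).aemeasurable
  · refine Filter.Eventually.of_forall fun z => ?_
    simp [Real.exp_pos]

/-- The entire functions that are square integrable for the Gaussian measure. -/
def fockSubmodule : Submodule ℂ (ℂ → ℂ) where
  carrier := {f | Differentiable ℂ f ∧ MemLp f 2 gaussian}
  add_mem' hf hg := ⟨hf.1.add hg.1, hf.2.add hg.2⟩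
  zero_mem' := ⟨differentiable_const 0, MemLp.zero⟩
  smul_mem' c _ hf := ⟨hf.1.const_smul c, hf.2.const_smul c⟩

/-- The Fock space `𝓕²`: entire functions in `L²(ℂ, dλ)`. It is a type of its own, so that it
carries the `L²(dλ)` topology and not the topology of pointwise convergence. -/
def FockSpace : Type := ↥fockSubmodule

instance : AddCommGroup FockSpace := inferInstanceAs (AddCommGroup ↥fockSubmodule)

instance : Module ℂ FockSpace := inferInstanceAs (Module ℂ ↥fockSubmodule)

instance : CoeFun FockSpace (fun _ => ℂ → ℂ) := ⟨fun f => f.1⟩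

/-- The inclusion of the Fock space in `L²(ℂ, dλ)`. -/
def toLp : FockSpace →ₗ[ℂ] Lp ℂ 2 gaussian where
  toFun f := f.2.2.toLp f.1
  map_add' f g := MemLp.toLp_add f.2.2 g.2.2
  map_smul' c f := MemLp.toLp_const_smul c f.2.2

lemma toLp_injective : Function.Injective toLp := by
  intro f g h
  have h1 : f.1 =ᵐ[gaussian] g.1 := (MemLp.toLp_eq_toLp_iff f.2.2 g.2.2).1 h
  have h2 : f.1 =ᵐ[volume] g.1 := volume_absolutelyContinuous_gaussian.ae_eq h1
  exact Subtype.ext (Continuous.ae_eq_iff_eq volume f.2.1.continuous g.2.1.continuous |>.1 h2)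

instance : NormedAddCommGroup FockSpace :=
  NormedAddCommGroup.induced FockSpace (Lp ℂ 2 gaussian) toLp toLp_injective

/-- The inner product of `L²(ℂ, dλ)`; as everywhere in Mathlib it is linear in the second
variable, so `inner ℂ g f = ∫ f(z) conj (g z) dλ(z)`. -/
instance : InnerProductSpace ℂ FockSpace where
  toNormedSpace := NormedSpace.induced ℂ FockSpace (Lp ℂ 2 gaussian) toLp
  inner f g := inner ℂ (toLp f) (toLp g)
  norm_sq_eq_re_inner f := norm_sq_eq_re_inner (𝕜 := ℂ) (toLp f)
  conj_inner_symm f g := inner_conj_symm (toLp f) (toLp g)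
  add_left f g h := by
    rw [map_add]
    exact inner_add_left _ _ _
  smul_left f g c := by
    rw [map_smul]
    exact inner_smul_left _ _ _

/-- The reproducing kernel `K_z(w) = exp (conj z * w / 2)`. -/
def kernel (z w : ℂ) : ℂ := Complex.exp (conj z * w / 2)

/-- The normalized reproducing kernel `k_z = K_z / ‖K_z‖`, that is
`k_z(w) = exp (w * conj z / 2 - |z|² / 4)`. -/
def normalizedKernel (z w : ℂ) : ℂ := Complex.exp (w * conj z / 2 - (‖z‖ : ℂ) ^ 2 / 4)

/-- Condition (M) for a positive measure. -/
def ConditionM (μ : Measure ℂ) : Prop :=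
  ∀ z : ℂ, ∫⁻ w, ENNReal.ofReal (‖kernel z w‖ ^ 2 * Real.exp (-‖w‖ ^ 2 / 2)) ∂μ < ⊤

/-- The Berezin transform of a positive measure. -/
def berezin (μ : Measure ℂ) (z : ℂ) : ℝ :=
  1 / 2 * ∫ w, ‖normalizedKernel z w‖ ^ 2 * Real.exp (-‖w‖ ^ 2 / 2) ∂μ

/-- `μ` is a reverse Carleson measure for the Fock space. -/
def IsReverseCarleson (μ : Measure ℂ) : Prop :=
  ∃ C : ℝ, 0 < C ∧ ∀ f : FockSpace,
    ENNReal.ofReal C * ∫⁻ w, ENNReal.ofReal (‖f w‖ ^ 2 * Real.exp (-‖w‖ ^ 2 / 2)) ∂area ≤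
      ∫⁻ w, ENNReal.ofReal (‖f w‖ ^ 2 * Real.exp (-‖w‖ ^ 2 / 2)) ∂μ

/-- `μ` satisfies the reverse Carleson condition for the Fock space. -/
def ReverseCarlesonCondition (μ : Measure ℂ) : Prop :=
  ∃ r C : ℝ, 0 < r ∧ 0 < C ∧ ∀ z : ℂ,
    ENNReal.ofReal C⁻¹ ≤ μ (Metric.ball z r) ∧ μ (Metric.ball z r) ≤ ENNReal.ofReal C

/-- The bounded operator `T` on the Fock space is the Toeplitz operator `T_μ` induced by `μ`:
`T f (z) = (1/2) ∫ f(w) conj (K_z(w)) exp (-|w|² / 2) dμ(w)`, with absolutely convergent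
integrals. There is at most one such `T`, see `IsToeplitz.unique`. -/
def IsToeplitz (μ : Measure ℂ) (T : FockSpace →L[ℂ] FockSpace) : Prop :=
  ∀ (f : FockSpace) (z : ℂ),
    Integrable (fun w => f w * conj (kernel z w) * (Real.exp (-‖w‖ ^ 2 / 2) : ℂ)) μ ∧
      T f z = 1 / 2 * ∫ w, f w * conj (kernel z w) * (Real.exp (-‖w‖ ^ 2 / 2) : ℂ) ∂μ

lemma IsToeplitz.unique {μ : Measure ℂ} {S T : FockSpace →L[ℂ] FockSpace}
    (hS : IsToeplitz μ S) (hT : IsToeplitz μ T) : S = T :=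
  ContinuousLinearMap.ext fun f =>
    Subtype.ext (funext fun z => (hS f z).2.trans (hT f z).2.symm)

/-- The lattice `Λ(ω, ω₁, ω₂) = {ω + m ω₁ + n ω₂ : m, n ∈ ℤ}`. -/
def lattice (ω ω₁ ω₂ : ℂ) : Set ℂ := {a | ∃ m n : ℤ, a = ω + m * ω₁ + n * ω₂}

end Fock

end

/-!
The argument rests on three facts about the Fock space.

*Sub-mean value property.* The Weyl translations `weyl z` preserve entire functions and translate
the weighted square modulus `density f w = |f(w)|² exp (-|w|² / 2)`. The mean value property over
discs centred at `0` therefore gives `density f z ≤ C ∫_{B(z, ρ)} density f dA` with `C` independent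
of `z` (`density_le_setLIntegral`). Summed over a lattice, this says that the point masses `ν` form
a Carleson measure (`tsum_density_le`); applied to `K_z` and `k_z` it yields condition (M) and the
upper bound on `ν(B(z, r))`. The lower bounds hold because every ball `B(z, r)` contains a lattice
point.

*The Toeplitz operator is `R* R`.* For a Carleson measure `μ`, restriction to `L²(μ)` is a bounded
operator `R`. The reproducing property, again obtained from the mean value property at `0` by
translation, and the completeness of the Fock space show that `R* R` is the Toeplitz operator
(`IsCarleson.isToeplitz`). If `R* R` is invertible then `‖f‖ ≤ C ‖R f‖`, which is the reverse
Carleson inequality (`IsCarleson.isReverseCarleson`). The failure of invertibility thus follows from the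
failure of that inequality.

*A theta function vanishing on the lattice.* The function `thetaSigma`, built from Jacobi's
`θ(·, i)`, vanishes on `ℤ + iℤ`, and `thetaModulus z = |thetaSigma z| exp (-π |z|² / 2)` is doubly
periodic. If `r > √(2π)`, then `thetaSigma (· / r)` is a nonzero element of the Fock space that
vanishes on the lattice. At the critical value `r = √(2π)` it just fails to be in the Fock space, by
periodicity. Its dilates `f_ε(w) = thetaSigma ((1 - ε) w / r)` do belong to the space, and at a
lattice point `a` the periodic modulus is evaluated at distance `ε |a| / r` from a zero. Hence
`∑ density f_ε a` is at most a constant times `∑ ε² |a|² exp (-ε |a|² / (2π))`, which is bounded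
uniformly in `ε` (`exists_tsum_density_thetaSigma_le`). A reverse Carleson inequality would bound
the norms of the `f_ε`, and Fatou's lemma would put `thetaSigma (· / r)` in the Fock space.
-/

open MeasureTheory ComplexConjugate

noncomputable section

namespace Fock

/-! ### The mean value property for radial weights -/

lemma norm_circleMap_zero_one_mul (θ : ℝ) (w : ℂ) : ‖circleMap 0 1 θ * w‖ = ‖w‖ := by
  simp

lemma measurePreserving_circleMap_mul (θ : ℝ) :
    MeasurePreserving (fun w : ℂ => circleMap 0 1 θ * w) := by
  have h := (rotation (Circle.exp θ)).measurePreserving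
  have h2 : (fun w : ℂ => circleMap 0 1 θ * w) = rotation (Circle.exp θ) := by
    ext w
    simp [circleMap, rotation_apply]
  rw [h2]
  exact h

lemma intervalIntegral_circleMap_mul {h : ℂ → ℂ} (hh : Differentiable ℂ h) (w : ℂ) :
    ∫ θ in (0 : ℝ)..2 * Real.pi, h (circleMap 0 1 θ * w) = 2 * Real.pi * h 0 := by
  have h1 : Differentiable ℂ fun ζ : ℂ => h (ζ * w) := by fun_prop
  have h2 := (h1.diffContOnCl (s := Metric.ball 0 |1|)).circleAverage
  rw [Real.circleAverage_def] at h2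
  have h3 : ((2 * Real.pi : ℝ) : ℂ) ≠ 0 := by
    exact_mod_cast (by positivity : (2 * Real.pi) ≠ 0)
  simp only [zero_mul, Complex.real_smul] at h2
  rw [← h2, Complex.ofReal_inv, ← mul_assoc]
  push_cast at h3 ⊢
  rw [mul_inv_cancel₀ h3, one_mul]

/-- Rotation invariance lets `h` be replaced by its average over circles centred at `0`, which is
`h 0` by the mean value property. -/
theorem integral_mul_radial {h : ℂ → ℂ} (hh : Differentiable ℂ h) {φ : ℝ → ℝ}
    (hφ : Measurable φ) (hi : Integrable fun w : ℂ => h w * φ ‖w‖) :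
    ∫ w : ℂ, h w * φ ‖w‖ = h 0 * ∫ w : ℂ, (φ ‖w‖ : ℂ) := by
  set F : ℂ → ℂ := fun w => h w * φ ‖w‖ with hF
  have hrot (θ : ℝ) : ∫ w, F (circleMap 0 1 θ * w) = ∫ w, F w := by
    rcases eq_or_ne (circleMap 0 1 θ) 0 with h0 | h0
    · simp [circleMap] at h0
    · exact (measurePreserving_circleMap_mul θ).integral_comp
        (Homeomorph.mulLeft₀ _ h0).measurableEmbedding F
  have hroti (θ : ℝ) : Integrable fun w => F (circleMap 0 1 θ * w) :=
    (measurePreserving_circleMap_mul θ).integrable_comp_of_integrable hi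
  have hrotn (θ : ℝ) : ∫ w, ‖F (circleMap 0 1 θ * w)‖ = ∫ w, ‖F w‖ := by
    rcases eq_or_ne (circleMap 0 1 θ) 0 with h0 | h0
    · simp [circleMap] at h0
    · exact (measurePreserving_circleMap_mul θ).integral_comp
        (Homeomorph.mulLeft₀ _ h0).measurableEmbedding fun w => ‖F w‖
  have hFm : Measurable F := by
    have := hh.continuous.measurable
    fun_prop
  have hprod : Integrable (Function.uncurry fun (θ : ℝ) (w : ℂ) => F (circleMap 0 1 θ * w))
      ((volume.restrict (Set.uIoc 0 (2 * Real.pi))).prod volume) := by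
    have hm : Measurable (Function.uncurry fun (θ : ℝ) (w : ℂ) => F (circleMap 0 1 θ * w)) := by
      refine hFm.comp ?_
      have := (continuous_circleMap 0 1).measurable
      fun_prop
    rw [integrable_prod_iff hm.aestronglyMeasurable]
    refine ⟨Filter.Eventually.of_forall hroti, ?_⟩
    simp only [Function.uncurry_apply_pair, hrotn]
    rw [Set.uIoc_of_le (by positivity)]
    exact integrable_const _
  have hswap := intervalIntegral_integral_swap hprod
  simp only [hrot] at hswap
  have hin (w : ℂ) : ∫ θ in (0 : ℝ)..2 * Real.pi, F (circleMap 0 1 θ * w) =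
      2 * Real.pi * h 0 * φ ‖w‖ := by
    simp only [hF, norm_circleMap_zero_one_mul, intervalIntegral.integral_mul_const,
      intervalIntegral_circleMap_mul hh]
  simp only [hin, intervalIntegral.integral_const, integral_const_mul, sub_zero,
    Complex.real_smul] at hswap
  have h3 : ((2 * Real.pi : ℝ) : ℂ) ≠ 0 := by
    exact_mod_cast (by positivity : (2 * Real.pi) ≠ 0)
  apply mul_left_cancel₀ h3
  rw [hswap]
  push_cast
  ring

/-! ### The weighted square modulus -/

/-- The weighted square modulus `|f(w)|² exp (-|w|² / 2)`. -/
def density (f : ℂ → ℂ) (w : ℂ) : ENNReal :=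
  ENNReal.ofReal (‖f w‖ ^ 2 * Real.exp (-‖w‖ ^ 2 / 2))

lemma continuous_density {f : ℂ → ℂ} (hf : Continuous f) : Continuous (density f) := by
  exact ENNReal.continuous_ofReal.comp (by fun_prop)

instance : SFinite area := by unfold area; infer_instance

instance : area.IsAddRightInvariant := by unfold area; infer_instance

lemma enorm_sq_mul_weight (f : ℂ → ℂ) (w : ℂ) :
    ENNReal.ofReal (1 / 2 * Real.exp (-‖w‖ ^ 2 / 2)) * ‖f w‖ₑ ^ 2 =
      ENNReal.ofReal (1 / 2) * density f w := by
  rw [density, ← ofReal_norm, ← ENNReal.ofReal_pow (norm_nonneg _),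
    ← ENNReal.ofReal_mul (by positivity), ← ENNReal.ofReal_mul (by positivity)]
  ring_nf

lemma lintegral_gaussian_enorm_sq (f : ℂ → ℂ) :
    ∫⁻ w, ‖f w‖ₑ ^ 2 ∂gaussian = ENNReal.ofReal (1 / 2) * ∫⁻ w, density f w ∂area := by
  rw [gaussian, lintegral_withDensity_eq_lintegral_mul_non_measurable _ (by fun_prop)
    (Filter.Eventually.of_forall fun _ => ENNReal.ofReal_lt_top),
    ← lintegral_const_mul' _ _ ENNReal.ofReal_ne_top]
  exact lintegral_congr fun w => enorm_sq_mul_weight f w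

lemma eLpNorm_two_sq {α : Type*} [MeasurableSpace α] (μ : Measure α) (f : α → ℂ) :
    eLpNorm f 2 μ ^ 2 = ∫⁻ w, ‖f w‖ₑ ^ 2 ∂μ := by
  have h := eLpNorm_nnreal_pow_eq_lintegral (μ := μ) (f := f) (p := 2) (by norm_num)
  simpa using h

lemma memLp_gaussian_iff {f : ℂ → ℂ} (hf : Continuous f) :
    MemLp f 2 gaussian ↔ ∫⁻ w, density f w ∂area < ⊤ := by
  have h1 : MemLp f 2 gaussian ↔ eLpNorm f 2 gaussian < ⊤ :=
    ⟨fun h => h.2, fun h => ⟨hf.aestronglyMeasurable, h⟩⟩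
  have h2 : eLpNorm f 2 gaussian < ⊤ ↔ eLpNorm f 2 gaussian ^ 2 < ⊤ := by
    simp [ENNReal.pow_lt_top_iff]
  rw [h1, h2, eLpNorm_two_sq, lintegral_gaussian_enorm_sq]
  constructor
  · intro h
    by_contra h2
    rw [not_lt, top_le_iff] at h2
    rw [h2, ENNReal.mul_top (by simp)] at h
    exact lt_irrefl _ h
  · exact fun h => ENNReal.mul_lt_top ENNReal.ofReal_lt_top h

lemma lintegral_density_eq (f : FockSpace) :
    ∫⁻ w, density f w ∂area = ENNReal.ofReal (2 * ‖f‖ ^ 2) := by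
  have h1 : ‖f‖ₑ = eLpNorm f 2 gaussian := Lp.enorm_toLp f.2.2
  have h2 : ‖f‖ₑ ^ 2 = ENNReal.ofReal (1 / 2) * ∫⁻ w, density f w ∂area := by
    rw [h1, eLpNorm_two_sq, lintegral_gaussian_enorm_sq]
  rw [ENNReal.ofReal_mul (by norm_num), ENNReal.ofReal_pow (norm_nonneg _), ofReal_norm, h2,
    ← mul_assoc, ← ENNReal.ofReal_mul (by norm_num)]
  norm_num

/-! ### Weyl translations and the sub-mean value property -/

/-- The Weyl translation `f ↦ f(· + z) k_{-z}`, which preserves entire functions and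
intertwines the weighted square modulus with the translation by `z`. -/
def weyl (z : ℂ) (f : ℂ → ℂ) (u : ℂ) : ℂ :=
  f (u + z) * Complex.exp (-(u * conj z / 2) - (‖z‖ : ℂ) ^ 2 / 4)

lemma differentiable_weyl (z : ℂ) {f : ℂ → ℂ} (hf : Differentiable ℂ f) :
    Differentiable ℂ (weyl z f) := by
  unfold weyl
  fun_prop

lemma norm_add_sq_complex (u z : ℂ) :
    ‖u + z‖ ^ 2 = ‖u‖ ^ 2 + 2 * (u * conj z).re + ‖z‖ ^ 2 := by
  simp only [Complex.sq_norm, Complex.normSq_apply, Complex.add_re, Complex.add_im,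
    Complex.mul_re, Complex.conj_re, Complex.conj_im]
  ring

lemma density_weyl (z : ℂ) (f : ℂ → ℂ) (u : ℂ) :
    density (weyl z f) u = density f (u + z) := by
  unfold density weyl
  rw [norm_mul, mul_pow, mul_assoc, Complex.norm_exp, ← Real.exp_nat_mul, ← Real.exp_add,
    norm_add_sq_complex]
  congr 3
  have h : ((‖z‖ : ℂ) ^ 2 / 4).re = ‖z‖ ^ 2 / 4 := by
    have h0 : (‖z‖ : ℂ) ^ 2 / 4 = ((‖z‖ ^ 2 / 4 : ℝ) : ℂ) := by
      push_cast
      rfl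
    rw [h0, Complex.ofReal_re]
  have h' : (u * conj z / 2).re = (u * conj z).re / 2 := by simp
  rw [Complex.sub_re, h, Complex.neg_re, h']
  push_cast
  ring

/-- Weighted sub-mean value property, with a constant that does not depend on the centre. -/
lemma density_le_setLIntegral {f : ℂ → ℂ} (hf : Differentiable ℂ f) {ρ : ℝ} (hρ : 0 < ρ) (z : ℂ) :
    density f z ≤ ENNReal.ofReal (Real.exp (ρ ^ 2 / 2) / ρ ^ 2) *
      ∫⁻ w in Metric.ball z ρ, density f w ∂area := by
  have hz : density f z = density (weyl z f) 0 := by simp [density_weyl]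
  have htrans : ∫⁻ w in Metric.ball z ρ, density f w ∂area =
      ∫⁻ u in Metric.ball 0 ρ, density (weyl z f) u ∂area := by
    have h := (measurePreserving_add_right area z).setLIntegral_comp_preimage_emb
      (measurableEmbedding_addRight z) (density f) (Metric.ball z ρ)
    have hb : (fun u => u + z) ⁻¹' Metric.ball z ρ = Metric.ball 0 ρ := by
      ext u
      simp [dist_eq_norm]
    rw [← h, hb]
    simp only [density_weyl]
  rw [hz, htrans]
  have hg : Differentiable ℂ (weyl z f) := differentiable_weyl z hf
  generalize weyl z f = g at hg
  -- the mean value property of the entire function `g ^ 2` on the disc of radius `ρ`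
  have hind (w : ℂ) : g w ^ 2 * ((Set.Iio ρ).indicator (fun _ => (1 : ℝ)) ‖w‖ : ℝ) =
      (Metric.ball (0 : ℂ) ρ).indicator (fun w => g w ^ 2) w := by
    by_cases h : ‖w‖ < ρ <;> simp [h, Set.indicator]
  have hcont : Continuous fun w => g w ^ 2 := by
    have := hg.continuous
    fun_prop
  have hint : IntegrableOn (fun w => g w ^ 2) (Metric.ball 0 ρ) :=
    (hcont.continuousOn.integrableOn_compact (isCompact_closedBall 0 ρ)).mono_set
      Metric.ball_subset_closedBall
  have hmean := integral_mul_radial (h := fun w => g w ^ 2) (by fun_prop)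
    (φ := (Set.Iio ρ).indicator fun _ => (1 : ℝ)) (measurable_const.indicator measurableSet_Iio)
    (by
      simp only [hind]
      exact hint.integrable_indicator measurableSet_ball)
  have hone : ∫ w : ℂ, (((Set.Iio ρ).indicator (fun _ => (1 : ℝ)) ‖w‖ : ℝ) : ℂ) =
      ((Real.pi * ρ ^ 2 : ℝ) : ℂ) := by
    have h1 (w : ℂ) : ((Set.Iio ρ).indicator (fun _ => (1 : ℝ)) ‖w‖ : ℝ) =
        (Metric.ball (0 : ℂ) ρ).indicator (fun _ => (1 : ℝ)) w := by
      by_cases h : ‖w‖ < ρ <;> simp [h, Set.indicator]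
    rw [integral_complex_ofReal]
    simp only [h1]
    rw [integral_indicator measurableSet_ball]
    simp [Measure.real, hρ.le]
    ring
  simp only [hind] at hmean
  rw [integral_indicator measurableSet_ball, hone] at hmean
  have hnorm : ENNReal.ofReal (Real.pi * ρ ^ 2) * ‖g 0‖ₑ ^ 2 ≤
      ∫⁻ w in Metric.ball 0 ρ, ‖g w‖ₑ ^ 2 := by
    have h := enorm_integral_le_lintegral_enorm (μ := volume.restrict (Metric.ball 0 ρ))
      fun w => g w ^ 2
    rw [hmean, enorm_mul, enorm_pow, mul_comm, ← ofReal_norm (Complex.ofReal _),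
      Complex.norm_real, Real.norm_of_nonneg (by positivity)] at h
    simpa only [enorm_pow] using h
  -- the weight is at least `exp (-ρ² / 2)` on the disc
  have hdens : ∫⁻ w in Metric.ball 0 ρ, ‖g w‖ₑ ^ 2 ≤
      ENNReal.ofReal (Real.exp (ρ ^ 2 / 2)) * ∫⁻ w in Metric.ball 0 ρ, density g w := by
    rw [← lintegral_const_mul' _ _ ENNReal.ofReal_ne_top]
    refine setLIntegral_mono' measurableSet_ball fun w hw => ?_
    rw [density, ← ENNReal.ofReal_mul (by positivity), ← ofReal_norm,
      ← ENNReal.ofReal_pow (norm_nonneg _), mul_left_comm, ← Real.exp_add]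
    refine ENNReal.ofReal_le_ofReal (le_mul_of_one_le_right (by positivity) ?_)
    rw [Real.one_le_exp_iff]
    have hw' : ‖w‖ < ρ := by simpa using hw
    nlinarith [norm_nonneg w]
  have harea : ∫⁻ w in Metric.ball 0 ρ, density g w ∂area =
      ENNReal.ofReal Real.pi⁻¹ * ∫⁻ w in Metric.ball 0 ρ, density g w := by
    rw [area, Measure.restrict_smul, lintegral_smul_measure, smul_eq_mul]
  have hg0 : density g 0 = ‖g 0‖ₑ ^ 2 := by
    rw [density, ← ofReal_norm, ← ENNReal.ofReal_pow (norm_nonneg _)]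
    simp
  have hpos : 0 < Real.pi * ρ ^ 2 := by positivity
  rw [hg0, harea]
  calc ‖g 0‖ₑ ^ 2 = ENNReal.ofReal (Real.pi * ρ ^ 2)⁻¹ *
        (ENNReal.ofReal (Real.pi * ρ ^ 2) * ‖g 0‖ₑ ^ 2) := by
        rw [← mul_assoc, ← ENNReal.ofReal_mul (by positivity), inv_mul_cancel₀ hpos.ne']
        simp
    _ ≤ ENNReal.ofReal (Real.pi * ρ ^ 2)⁻¹ * (ENNReal.ofReal (Real.exp (ρ ^ 2 / 2)) *
        ∫⁻ w in Metric.ball 0 ρ, density g w) := by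
        exact mul_le_mul_right (hnorm.trans hdens) _
    _ = _ := by
        rw [← mul_assoc, ← mul_assoc, ← ENNReal.ofReal_mul (by positivity),
          ← ENNReal.ofReal_mul (by positivity)]
        congr 2
        field_simp

/-! ### The reproducing kernel -/

lemma norm_kernel (z w : ℂ) : ‖kernel z w‖ = Real.exp ((conj z * w).re / 2) := by
  rw [kernel, Complex.norm_exp]
  simp

lemma density_kernel (z w : ℂ) :
    density (kernel z) w =
      ENNReal.ofReal (Real.exp (‖z‖ ^ 2 / 2) * Real.exp (-‖w - z‖ ^ 2 / 2)) := by
  unfold density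
  have h := norm_add_sq_complex w (-z)
  rw [← sub_eq_add_neg, norm_neg, map_neg, mul_neg, Complex.neg_re, mul_comm w] at h
  rw [norm_kernel, ← Real.exp_nat_mul, ← Real.exp_add, ← Real.exp_add, h]
  push_cast
  ring_nf

lemma integrable_exp_neg_mul_sq {b : ℝ} (hb : 0 < b) :
    Integrable fun w : ℂ => Real.exp (-b * ‖w‖ ^ 2) := by
  have h := GaussianFourier.integrable_cexp_neg_mul_sq_norm_add (V := ℂ) (b := b)
    (by simpa using hb) 0 0
  refine h.norm.congr (Filter.Eventually.of_forall fun w => ?_)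
  simp only [Complex.norm_exp]
  congr 1
  simp [← Complex.ofReal_pow]

lemma integrable_exp_neg_sq : Integrable fun w : ℂ => Real.exp (-‖w‖ ^ 2 / 2) := by
  refine (integrable_exp_neg_mul_sq (b := 1 / 2) (by norm_num)).congr
    (Filter.Eventually.of_forall fun w => ?_)
  ring_nf

lemma integral_exp_neg_sq : ∫ w : ℂ, Real.exp (-‖w‖ ^ 2 / 2) = 2 * Real.pi := by
  have h := GaussianFourier.integral_rexp_neg_mul_sq_norm (V := ℂ) (b := 1 / 2) (by norm_num)
  rw [Complex.finrank_real_complex] at h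
  norm_num at h
  have h2 : 2 * Real.pi = Real.pi / (1 / 2) := by ring
  rw [h2, ← h]
  congr 1
  ext w
  ring_nf

lemma lintegral_density_kernel_lt_top (z : ℂ) : ∫⁻ w, density (kernel z) w ∂area < ⊤ := by
  simp only [density_kernel]
  rw [area, lintegral_smul_measure, smul_eq_mul]
  refine ENNReal.mul_lt_top ENNReal.ofReal_lt_top ?_
  refine Integrable.lintegral_lt_top ?_
  exact (integrable_exp_neg_sq.comp_sub_right z).const_mul _

lemma differentiable_kernel (z : ℂ) : Differentiable ℂ (kernel z) := by
  unfold kernel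
  fun_prop

/-- The reproducing kernel at `z` as an element of the Fock space. -/
def kernelFock (z : ℂ) : FockSpace :=
  ⟨kernel z, differentiable_kernel z,
    (memLp_gaussian_iff (differentiable_kernel z).continuous).2 (lintegral_density_kernel_lt_top z)⟩

lemma integral_gaussian (F : ℂ → ℂ) :
    ∫ w, F w ∂gaussian =
      ((2 * Real.pi)⁻¹ : ℝ) * ∫ w, F w * (Real.exp (-‖w‖ ^ 2 / 2) : ℂ) := by
  rw [gaussian, integral_withDensity_eq_integral_toReal_smul (by fun_prop)
    (Filter.Eventually.of_forall fun _ => ENNReal.ofReal_lt_top), area, integral_smul_measure,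
    ENNReal.toReal_ofReal (by positivity), ← integral_const_mul, ← integral_smul]
  refine integral_congr_ae (Filter.Eventually.of_forall fun w => ?_)
  simp only [ENNReal.toReal_ofReal (show 0 ≤ 1 / 2 * Real.exp (-‖w‖ ^ 2 / 2) by positivity),
    Complex.real_smul]
  push_cast
  ring

lemma integrable_gaussian_iff (F : ℂ → ℂ) :
    Integrable F gaussian ↔ Integrable fun w => F w * (Real.exp (-‖w‖ ^ 2 / 2) : ℂ) := by
  rw [gaussian, integrable_withDensity_iff_integrable_smul' (by fun_prop)
    (Filter.Eventually.of_forall fun _ => ENNReal.ofReal_lt_top), area,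
    integrable_smul_measure (by simp [Real.pi_pos]) ENNReal.ofReal_ne_top,
    ← integrable_const_mul_iff (c := (2 : ℂ)) (by simp)]
  refine integrable_congr (Filter.Eventually.of_forall fun w => ?_)
  simp only [ENNReal.toReal_ofReal (show 0 ≤ 1 / 2 * Real.exp (-‖w‖ ^ 2 / 2) by positivity),
    Complex.real_smul]
  push_cast
  ring

lemma conj_kernel_mul_weight (z u : ℂ) :
    conj (kernel z (u + z)) * (Real.exp (-‖u + z‖ ^ 2 / 2) : ℂ) =
      Complex.exp (-(u * conj z / 2)) * (Real.exp (-‖u‖ ^ 2 / 2) : ℂ) := by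
  have h (v : ℂ) : ((-‖v‖ ^ 2 / 2 : ℝ) : ℂ) = -(v * conj v) / 2 := by
    rw [Complex.mul_conj, Complex.normSq_eq_norm_sq]
    push_cast
    ring
  rw [kernel, ← Complex.exp_conj, Complex.ofReal_exp, Complex.ofReal_exp, h, h,
    ← Complex.exp_add, ← Complex.exp_add]
  congr 1
  simp only [map_div₀, map_mul, Complex.conj_conj, map_add, Complex.conj_ofNat]
  ring

/-- The reproducing property of the kernel. -/
theorem inner_kernelFock (z : ℂ) (f : FockSpace) : inner ℂ (kernelFock z) f = f z := by
  have h1 : inner ℂ (kernelFock z) f = inner ℂ (toLp (kernelFock z)) (toLp f) := rfl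
  have hae : (fun w => inner ℂ (toLp (kernelFock z) w) (toLp f w)) =ᵐ[gaussian]
      fun w => f w * conj (kernel z w) := by
    filter_upwards [MemLp.coeFn_toLp (kernelFock z).2.2, MemLp.coeFn_toLp f.2.2] with w hw1 hw2
    change inner ℂ ((kernelFock z).2.2.toLp _ w) (f.2.2.toLp _ w) = _
    rw [hw1, hw2]
    rfl
  have hint : Integrable (fun w => f w * conj (kernel z w)) gaussian :=
    (L2.integrable_inner (𝕜 := ℂ) (toLp (kernelFock z)) (toLp f)).congr hae
  rw [h1, L2.inner_def, integral_congr_ae hae, integral_gaussian]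
  rw [integrable_gaussian_iff] at hint
  -- translation by `z` turns the integral into a radially weighted integral of an entire function
  set g : ℂ → ℂ := fun u => f (u + z) * Complex.exp (-(u * conj z / 2)) with hg
  have hfun (u : ℂ) : f (u + z) * conj (kernel z (u + z)) * (Real.exp (-‖u + z‖ ^ 2 / 2) : ℂ) =
      g u * ((fun t : ℝ => Real.exp (-t ^ 2 / 2)) ‖u‖ : ℝ) := by
    rw [mul_assoc, conj_kernel_mul_weight, hg, mul_assoc]
  have hgd : Differentiable ℂ g := by
    have := f.2.1
    fun_prop
  have hm := integral_mul_radial hgd (φ := fun t => Real.exp (-t ^ 2 / 2)) (by fun_prop) (by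
    have := hint.comp_add_right z
    simpa only [hfun] using this)
  rw [← integral_add_right_eq_self _ z]
  simp only [hfun]
  rw [hm, integral_complex_ofReal, integral_exp_neg_sq]
  have h3 : ((2 * Real.pi : ℝ) : ℂ) ≠ 0 := by
    exact_mod_cast (by positivity : (2 * Real.pi) ≠ 0)
  rw [Complex.ofReal_inv, mul_left_comm, inv_mul_cancel₀ h3]
  simp [hg]

/-! ### Completeness of the Fock space -/

lemma norm_apply_sq_le (f : FockSpace) (z : ℂ) :
    ‖f z‖ ^ 2 ≤ 2 * Real.exp (1 / 2) * Real.exp (‖z‖ ^ 2 / 2) * ‖f‖ ^ 2 := by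
  have h := (density_le_setLIntegral f.2.1 one_pos z).trans
    (mul_le_mul_right (setLIntegral_le_lintegral _ _) _)
  rw [lintegral_density_eq, ← ENNReal.ofReal_mul (by positivity), density,
    ENNReal.ofReal_le_ofReal_iff (by positivity)] at h
  have h2 : Real.exp (‖z‖ ^ 2 / 2) * Real.exp (-‖z‖ ^ 2 / 2) = 1 := by
    rw [← Real.exp_add]
    ring_nf
    simp
  calc ‖f z‖ ^ 2 = Real.exp (‖z‖ ^ 2 / 2) * (‖f z‖ ^ 2 * Real.exp (-‖z‖ ^ 2 / 2)) := by
        rw [mul_left_comm, h2, mul_one]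
    _ ≤ Real.exp (‖z‖ ^ 2 / 2) * (Real.exp (1 ^ 2 / 2) / 1 ^ 2 * (2 * ‖f‖ ^ 2)) := by gcongr
    _ = _ := by norm_num; ring

lemma norm_apply_le_of_norm_le (f : FockSpace) {z : ℂ} {R : ℝ} (hz : ‖z‖ ≤ R) :
    ‖f z‖ ≤ √(2 * Real.exp (1 / 2) * Real.exp (R ^ 2 / 2)) * ‖f‖ := by
  refine le_of_sq_le_sq ?_ (by positivity)
  rw [mul_pow, Real.sq_sqrt (by positivity)]
  refine (norm_apply_sq_le f z).trans ?_
  gcongr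

lemma sub_apply (f g : FockSpace) (z : ℂ) : (f - g) z = f z - g z := rfl

/-- Norm convergence in the Fock space forces locally uniform convergence, so the `L²` limit of
a Cauchy sequence is represented by an entire function. -/
instance : CompleteSpace FockSpace := by
  refine Metric.complete_of_cauchySeq_tendsto fun u hu => ?_
  have hiso : Isometry (toLp : FockSpace → Lp ℂ 2 gaussian) :=
    AddMonoidHomClass.isometry_of_norm toLp fun _ => rfl
  have hu' : CauchySeq fun n => toLp (u n) := hiso.uniformContinuous.comp_cauchySeq hu
  obtain ⟨F, hF⟩ := cauchySeq_tendsto_of_complete hu'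
  have hunif (R : ℝ) : UniformCauchySeqOn (fun n => (u n : ℂ → ℂ)) Filter.atTop
      (Metric.closedBall 0 R) := by
    rw [Metric.uniformCauchySeqOn_iff]
    intro ε hε
    set M := √(2 * Real.exp (1 / 2) * Real.exp (R ^ 2 / 2)) with hM
    have hMpos : 0 < M := by positivity
    obtain ⟨N, hN⟩ := Metric.cauchySeq_iff.1 hu (ε / M) (by positivity)
    refine ⟨N, fun m hm n hn z hz => ?_⟩
    rw [dist_eq_norm, ← sub_apply]
    refine (norm_apply_le_of_norm_le _ (by simpa using hz)).trans_lt ?_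
    have := hN m hm n hn
    rw [dist_eq_norm] at this
    calc M * ‖u m - u n‖ < M * (ε / M) := by gcongr
      _ = ε := by field_simp
  have hlim (z : ℂ) : ∃ l, Filter.Tendsto (fun n => u n z) Filter.atTop (nhds l) :=
    cauchySeq_tendsto_of_complete ((hunif ‖z‖).cauchySeq (by simp))
  choose f hf using hlim
  have hfd : Differentiable ℂ f := by
    rw [← differentiableOn_univ]
    refine TendstoLocallyUniformlyOn.differentiableOn (F := fun n => (u n : ℂ → ℂ))
      (φ := Filter.atTop) ?_ (Filter.Eventually.of_forall fun n => (u n).2.1.differentiableOn)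
      isOpen_univ
    rw [tendstoLocallyUniformlyOn_iff_forall_isCompact isOpen_univ]
    intro K _ hK
    obtain ⟨R, hR⟩ := hK.isBounded.subset_closedBall 0
    exact ((hunif R).mono hR).tendstoUniformlyOn_of_tendsto fun z _ => hf z
  -- an a.e. convergent subsequence identifies the `L²` limit with the pointwise limit
  have hae : (F : ℂ → ℂ) =ᵐ[gaussian] f := by
    obtain ⟨ns, hns, h⟩ := (tendstoInMeasure_of_tendsto_Lp hF).exists_seq_tendsto_ae
    have hall : ∀ᵐ z ∂gaussian, ∀ n, toLp (u n) z = u n z :=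
      ae_all_iff.2 fun n => MemLp.coeFn_toLp (u n).2.2
    filter_upwards [h, hall] with z hz hz2
    refine tendsto_nhds_unique hz ?_
    simp only [hz2]
    exact (hf z).comp hns.tendsto_atTop
  have hmem : MemLp f 2 gaussian := (memLp_congr_ae hae).1 (Lp.memLp F)
  obtain ⟨g, hg⟩ : ∃ g : FockSpace, g.1 = f := ⟨⟨f, hfd, hmem⟩, rfl⟩
  refine ⟨g, hiso.isEmbedding.tendsto_nhds_iff.2 ?_⟩
  have hFg : toLp g = F := by
    rw [← Lp.toLp_coeFn F (Lp.memLp F)]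
    exact (MemLp.toLp_eq_toLp_iff g.2.2 (Lp.memLp F)).2 (hg ▸ hae.symm)
  rw [hFg]
  exact hF

/-! ### Toeplitz operators of Carleson measures -/

/-- `μ` is a Carleson measure for the Fock space. -/
def IsCarleson (μ : Measure ℂ) : Prop :=
  ∃ C : ENNReal, C ≠ ⊤ ∧ ∀ f : FockSpace, ∫⁻ w, density f w ∂μ ≤ C * ∫⁻ w, density f w ∂area

/-- Multiplication by the square root of the Gaussian weight, the isometry of `L²(ℂ, dλ)` onto
`L²(ℂ, dA)`. -/
def weighted (f : ℂ → ℂ) (w : ℂ) : ℂ := f w * (√(1 / 2 * Real.exp (-‖w‖ ^ 2 / 2)) : ℝ)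

lemma enorm_weighted_sq (f : ℂ → ℂ) (w : ℂ) :
    ‖weighted f w‖ₑ ^ 2 = ENNReal.ofReal (1 / 2) * density f w := by
  rw [← enorm_sq_mul_weight, weighted, enorm_mul, mul_pow, mul_comm,
    ← ofReal_norm (Complex.ofReal _), Complex.norm_real, Real.norm_of_nonneg (by positivity),
    ← ENNReal.ofReal_pow (by positivity),
    Real.sq_sqrt (by positivity)]

lemma eLpNorm_weighted_sq (μ : Measure ℂ) (f : ℂ → ℂ) :
    eLpNorm (weighted f) 2 μ ^ 2 = ENNReal.ofReal (1 / 2) * ∫⁻ w, density f w ∂μ := by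
  rw [eLpNorm_two_sq, ← lintegral_const_mul' _ _ ENNReal.ofReal_ne_top]
  exact lintegral_congr fun w => enorm_weighted_sq f w

lemma continuous_weighted {f : ℂ → ℂ} (hf : Continuous f) : Continuous (weighted f) := by
  unfold weighted
  fun_prop

lemma IsCarleson.lintegral_lt_top {μ : Measure ℂ} (hμ : IsCarleson μ) (f : FockSpace) :
    ∫⁻ w, density f w ∂μ < ⊤ := by
  obtain ⟨C, hC, h⟩ := hμ
  refine (h f).trans_lt (ENNReal.mul_lt_top hC.lt_top ?_)
  rw [lintegral_density_eq]
  exact ENNReal.ofReal_lt_top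

lemma IsCarleson.memLp_weighted {μ : Measure ℂ} (hμ : IsCarleson μ) (f : FockSpace) :
    MemLp (weighted f) 2 μ := by
  refine ⟨(continuous_weighted f.2.1.continuous).aestronglyMeasurable, ?_⟩
  have h := eLpNorm_weighted_sq μ f
  have h2 : eLpNorm (weighted f) 2 μ ^ 2 < ⊤ := by
    rw [h]
    exact ENNReal.mul_lt_top ENNReal.ofReal_lt_top (hμ.lintegral_lt_top f)
  simpa [ENNReal.pow_lt_top_iff] using h2

lemma IsCarleson.ofReal_norm_toLp_sq {μ : Measure ℂ} (hμ : IsCarleson μ) (f : FockSpace) :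
    ENNReal.ofReal (‖(hμ.memLp_weighted f).toLp (weighted f)‖ ^ 2) =
      ENNReal.ofReal (1 / 2) * ∫⁻ w, density f w ∂μ := by
  rw [← eLpNorm_weighted_sq, ← Lp.enorm_toLp (hμ.memLp_weighted f),
    ENNReal.ofReal_pow (norm_nonneg _), ofReal_norm]

/-- The bounded restriction operator `f ↦ weighted f` of the Fock space to `L²(μ)`, for a Carleson
measure `μ`. -/
def IsCarleson.restrict {μ : Measure ℂ} (hμ : IsCarleson μ) : FockSpace →L[ℂ] Lp ℂ 2 μ :=
  LinearMap.mkContinuous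
    { toFun := fun f => (hμ.memLp_weighted f).toLp (weighted f)
      map_add' := fun f g => by
        rw [← MemLp.toLp_add]
        congr 1
        ext w
        exact add_mul _ _ _
      map_smul' := fun c f => by
        rw [RingHom.id_apply, ← MemLp.toLp_const_smul]
        congr 1
        ext w
        exact mul_assoc _ _ _ }
    (√hμ.choose.toReal) (fun f => by
      refine le_of_sq_le_sq ?_ (by positivity)
      rw [mul_pow, Real.sq_sqrt ENNReal.toReal_nonneg,
        ← ENNReal.ofReal_le_ofReal_iff (by positivity)]
      refine (hμ.ofReal_norm_toLp_sq f).trans_le ?_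
      refine (mul_le_mul_right (hμ.choose_spec.2 f) _).trans_eq ?_
      rw [lintegral_density_eq, ENNReal.ofReal_mul ENNReal.toReal_nonneg,
        ENNReal.ofReal_toReal hμ.choose_spec.1, mul_left_comm, ← ENNReal.ofReal_mul (by norm_num)]
      congr 2
      ring)

lemma IsCarleson.coeFn_restrict {μ : Measure ℂ} (hμ : IsCarleson μ) (f : FockSpace) :
    (hμ.restrict f : ℂ → ℂ) =ᵐ[μ] weighted f :=
  MemLp.coeFn_toLp (hμ.memLp_weighted f)

lemma IsCarleson.ofReal_norm_restrict_sq {μ : Measure ℂ} (hμ : IsCarleson μ) (f : FockSpace) :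
    ENNReal.ofReal (2 * ‖hμ.restrict f‖ ^ 2) = ∫⁻ w, density f w ∂μ := by
  rw [ENNReal.ofReal_mul (by norm_num)]
  refine (congrArg _ (hμ.ofReal_norm_toLp_sq f)).trans ?_
  rw [← mul_assoc, ← ENNReal.ofReal_mul (by norm_num)]
  norm_num

/-- The Toeplitz operator of a Carleson measure, as `R* R` for the restriction operator `R` to
`L²(μ)`. -/
def IsCarleson.toeplitz {μ : Measure ℂ} (hμ : IsCarleson μ) : FockSpace →L[ℂ] FockSpace :=
  hμ.restrict.adjoint ∘L hμ.restrict

theorem IsCarleson.isToeplitz {μ : Measure ℂ} (hμ : IsCarleson μ) :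
    IsToeplitz μ hμ.toeplitz := by
  intro f z
  have hae : (fun w => inner ℂ (hμ.restrict (kernelFock z) w) (hμ.restrict f w)) =ᵐ[μ]
      fun w => 1 / 2 * (f w * conj (kernel z w) * (Real.exp (-‖w‖ ^ 2 / 2) : ℂ)) := by
    filter_upwards [hμ.coeFn_restrict (kernelFock z), hμ.coeFn_restrict f] with w h1 h2
    have hs : ((√(1 / 2 * Real.exp (-‖w‖ ^ 2 / 2)) : ℝ) : ℂ) *
        ((√(1 / 2 * Real.exp (-‖w‖ ^ 2 / 2)) : ℝ) : ℂ) =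
          1 / 2 * (Real.exp (-‖w‖ ^ 2 / 2) : ℂ) := by
      rw [← Complex.ofReal_mul, Real.mul_self_sqrt (by positivity)]
      push_cast
      rfl
    rw [h1, h2, weighted, weighted, RCLike.inner_apply, map_mul, Complex.conj_ofReal]
    change f w * _ * (conj (kernel z w) * _) = _
    rw [mul_mul_mul_comm, hs]
    ring
  have hint := (L2.integrable_inner (𝕜 := ℂ) (hμ.restrict (kernelFock z)) (hμ.restrict f)).congr hae
  rw [integrable_const_mul_iff (by simp)] at hint
  refine ⟨hint, ?_⟩
  rw [← inner_kernelFock, IsCarleson.toeplitz, ContinuousLinearMap.comp_apply,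
    ContinuousLinearMap.adjoint_inner_right, L2.inner_def, integral_congr_ae hae,
    integral_const_mul]

/-- Since `⟪T f, f⟫ = ‖R f‖²`, invertibility of `T = R* R` bounds the restriction operator `R`
from below. -/
theorem IsCarleson.isReverseCarleson {μ : Measure ℂ} (hμ : IsCarleson μ)
    (hT : IsUnit hμ.toeplitz) : IsReverseCarleson μ := by
  obtain ⟨U, hU⟩ := hT
  set S : FockSpace →L[ℂ] FockSpace := ↑U⁻¹ with hS
  have hST (f : FockSpace) : S (hμ.restrict.adjoint (hμ.restrict f)) = f := by
    have h1 : S * hμ.toeplitz = 1 := by rw [← hU, hS, Units.inv_mul]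
    exact congrArg (fun A : FockSpace →L[ℂ] FockSpace => A f) h1
  set M := ‖S‖ * ‖hμ.restrict.adjoint‖ + 1 with hM
  have hMpos : 0 < M := by positivity
  have hle (f : FockSpace) : ‖f‖ ≤ M * ‖hμ.restrict f‖ := by
    calc ‖f‖ = ‖S (hμ.restrict.adjoint (hμ.restrict f))‖ := by rw [hST]
      _ ≤ ‖S‖ * (‖hμ.restrict.adjoint‖ * ‖hμ.restrict f‖) :=
        S.le_opNorm_of_le (ContinuousLinearMap.le_opNorm _ _)
      _ ≤ M * ‖hμ.restrict f‖ := by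
        rw [← mul_assoc]
        gcongr
        linarith
  refine ⟨(M ^ 2)⁻¹, by positivity, fun f => ?_⟩
  change _ * ∫⁻ w, density f w ∂area ≤ ∫⁻ w, density f w ∂μ
  rw [lintegral_density_eq, ← hμ.ofReal_norm_restrict_sq, ← ENNReal.ofReal_mul (by positivity)]
  refine ENNReal.ofReal_le_ofReal ?_
  rw [inv_mul_le_iff₀ (by positivity)]
  have := pow_le_pow_left₀ (norm_nonneg _) (hle f) 2
  linarith [mul_pow M ‖hμ.restrict f‖ 2]

/-! ### A theta function with zeros at the Gaussian integers -/

/-- An entire function vanishing on the Gaussian integers, of the type of the Weierstrass `σ`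
function: the theta function `θ(·, i)`, shifted so that its zeros are at the Gaussian integers, and
multiplied by a Gaussian factor so that `|thetaSigma z| exp (-π |z|² / 2)` is doubly periodic. -/
def thetaSigma (z : ℂ) : ℂ :=
  Complex.exp (Real.pi * z ^ 2 / 2 + Complex.I * Real.pi * z) *
    jacobiTheta₂ (z + (1 + Complex.I) / 2) Complex.I

/-- The doubly periodic weighted modulus of `thetaSigma`. -/
def thetaModulus (z : ℂ) : ℝ := ‖thetaSigma z‖ * Real.exp (-Real.pi * ‖z‖ ^ 2 / 2)

lemma differentiable_thetaSigma : Differentiable ℂ thetaSigma := by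
  intro z
  have h1 : DifferentiableAt ℂ (fun z => jacobiTheta₂ (z + (1 + Complex.I) / 2) Complex.I) z :=
    (differentiableAt_jacobiTheta₂_fst (z + (1 + Complex.I) / 2) (by simp)).comp z
      (differentiableAt_id.add_const ((1 + Complex.I) / 2))
  exact DifferentiableAt.mul (by fun_prop) h1

lemma continuous_thetaModulus : Continuous thetaModulus := by
  have := differentiable_thetaSigma.continuous
  unfold thetaModulus
  fun_prop

lemma thetaModulus_nonneg (z : ℂ) : 0 ≤ thetaModulus z := by
  unfold thetaModulus
  positivity

lemma thetaModulus_eq (z : ℂ) :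
    thetaModulus z = Real.exp (-Real.pi * (z.im ^ 2 + z.im)) *
      ‖jacobiTheta₂ (z + (1 + Complex.I) / 2) Complex.I‖ := by
  rw [thetaModulus, thetaSigma, norm_mul, mul_right_comm, Complex.norm_exp, ← Real.exp_add]
  congr 2
  have h : (Real.pi * z ^ 2 / 2 + Complex.I * Real.pi * z : ℂ).re =
      Real.pi * (z.re ^ 2 - z.im ^ 2) / 2 - Real.pi * z.im := by
    have h1 : (Real.pi * z ^ 2 / 2 + Complex.I * Real.pi * z : ℂ) =
        ((Real.pi / 2 : ℝ) : ℂ) * z ^ 2 + (Real.pi : ℝ) * (Complex.I * z) := by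
      push_cast
      ring
    rw [h1, Complex.add_re, Complex.re_ofReal_mul, Complex.re_ofReal_mul, sq, Complex.mul_re,
      Complex.I_mul_re]
    ring
  rw [h, Complex.sq_norm, Complex.normSq_apply]
  ring

lemma thetaModulus_add_one (z : ℂ) : thetaModulus (z + 1) = thetaModulus z := by
  rw [thetaModulus_eq, thetaModulus_eq, add_right_comm, jacobiTheta₂_add_left]
  simp

lemma thetaModulus_add_I (z : ℂ) : thetaModulus (z + Complex.I) = thetaModulus z := by
  rw [thetaModulus_eq, thetaModulus_eq, add_right_comm, jacobiTheta₂_add_left', norm_mul,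
    ← mul_assoc, Complex.norm_exp, ← Real.exp_add]
  congr 2
  have h : (-Real.pi * Complex.I * (Complex.I + 2 * (z + (1 + Complex.I) / 2)) : ℂ) =
      (Real.pi : ℝ) * (2 - Complex.I * (2 * z + 1)) := by
    linear_combination (-2 * Real.pi : ℂ) * Complex.I_sq
  rw [h, Complex.re_ofReal_mul, Complex.sub_re, Complex.I_mul_re]
  simp
  ring

lemma thetaModulus_add_gaussianInt (z : ℂ) (m n : ℤ) :
    thetaModulus (z + (m + n * Complex.I)) = thetaModulus z := by
  have h1 : Function.Periodic thetaModulus (1 : ℂ) := thetaModulus_add_one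
  have h2 : Function.Periodic thetaModulus Complex.I := thetaModulus_add_I
  rw [← add_assoc, h2.int_mul n, ← mul_one (m : ℂ), h1.int_mul m]

/-- The point `v = (1 + i) / 2` differs from `-v` by the quasi-period `1 + i`; evenness and
quasi-periodicity give `θ(v, i) = -θ(v, i)`. -/
lemma thetaSigma_zero : thetaSigma 0 = 0 := by
  set v : ℂ := (1 + Complex.I) / 2 with hv
  have h1 : jacobiTheta₂ (-v + 1 + Complex.I) Complex.I =
      -jacobiTheta₂ v Complex.I := by
    rw [jacobiTheta₂_add_left', jacobiTheta₂_add_left, jacobiTheta₂_neg_left]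
    have h : (-Real.pi * Complex.I * (Complex.I + 2 * (-v + 1)) : ℂ) =
        -(Real.pi * Complex.I) := by
      rw [hv]
      ring
    rw [h, Complex.exp_neg, Complex.exp_pi_mul_I]
    norm_num
  have h2 : -v + 1 + Complex.I = v := by
    rw [hv]
    ring
  rw [h2] at h1
  have h3 : jacobiTheta₂ v Complex.I = 0 := by
    linear_combination h1 / 2
  rw [thetaSigma, zero_add, h3, mul_zero]

lemma jacobiTheta_I_ne_zero : jacobiTheta Complex.I ≠ 0 := by
  intro h
  have h1 := norm_jacobiTheta_sub_one_le (τ := Complex.I) (by simp)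
  rw [h] at h1
  simp only [zero_sub, norm_neg, norm_one, Complex.I_im, mul_one] at h1
  have h2 : Real.exp (-Real.pi) < 1 / 4 := by
    rw [Real.exp_neg, inv_lt_comm₀ (Real.exp_pos _) (by norm_num)]
    have := Real.add_one_lt_exp Real.pi_pos.ne'
    have := Real.pi_gt_three
    norm_num
    linarith
  rw [div_mul_eq_mul_div, le_div_iff₀ (by linarith)] at h1
  linarith

/-- The base point is chosen so that the shift in `thetaSigma` brings it to `0`, where `θ(0, i)` is
close to `1`. -/
lemma thetaModulus_ne_zero : thetaModulus (-((1 + Complex.I) / 2)) ≠ 0 := by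
  rw [thetaModulus_eq, neg_add_cancel, ← jacobiTheta_eq_jacobiTheta₂]
  exact mul_ne_zero (Real.exp_pos _).ne' (norm_ne_zero_iff.2 jacobiTheta_I_ne_zero)

lemma exists_gaussianInt_norm_sub_lt (z : ℂ) : ∃ m n : ℤ, ‖z - (m + n * Complex.I)‖ < 1 := by
  refine ⟨round z.re, round z.im, ?_⟩
  have h1 := abs_le.1 (abs_sub_round z.re)
  have h2 := abs_le.1 (abs_sub_round z.im)
  rw [← sq_lt_one_iff₀ (norm_nonneg _), Complex.sq_norm, Complex.normSq_apply]
  simp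
  nlinarith

lemma exists_thetaModulus_le : ∃ B : ℝ, ∀ z, thetaModulus z ≤ B := by
  obtain ⟨B, hB⟩ := (isCompact_closedBall (0 : ℂ) 1).exists_bound_of_continuousOn
    continuous_thetaModulus.continuousOn
  refine ⟨B, fun z => ?_⟩
  obtain ⟨m, n, h⟩ := exists_gaussianInt_norm_sub_lt z
  rw [← sub_add_cancel z (m + n * Complex.I), thetaModulus_add_gaussianInt]
  exact (le_abs_self _).trans (hB _ (by simpa using h.le))

lemma exists_thetaModulus_le_mul_norm : ∃ C : ℝ, ∀ z, thetaModulus z ≤ C * ‖z‖ := by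
  obtain ⟨B, hB⟩ := exists_thetaModulus_le
  have h0 := (differentiable_thetaSigma 0).isBigO_sub
  simp only [thetaSigma_zero, sub_zero] at h0
  obtain ⟨c, hc⟩ := h0.bound
  obtain ⟨δ, hδ, h⟩ := Metric.eventually_nhds_iff.1 hc
  have hB0 : 0 ≤ B := (thetaModulus_nonneg 0).trans (hB 0)
  refine ⟨max c (B / δ), fun z => ?_⟩
  rcases lt_or_ge ‖z‖ δ with hz | hz
  · calc thetaModulus z ≤ ‖thetaSigma z‖ := by
          refine mul_le_of_le_one_right (norm_nonneg _) (Real.exp_le_one_iff.2 ?_)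
          have : 0 ≤ Real.pi * ‖z‖ ^ 2 := by positivity
          linarith
      _ ≤ c * ‖z‖ := h (by simpa using hz)
      _ ≤ _ := by
        gcongr
        exact le_max_left _ _
  · calc thetaModulus z ≤ B := hB z
      _ = B / δ * δ := by field_simp
      _ ≤ B / δ * ‖z‖ := by gcongr
      _ ≤ _ := by
        gcongr
        exact le_max_right _ _

lemma density_thetaSigma_comp_mul (s : ℝ) (w : ℂ) :
    density (fun w => thetaSigma (s * w)) w =
      ENNReal.ofReal (thetaModulus (s * w) ^ 2 *
        Real.exp (-(1 / 2 - Real.pi * s ^ 2) * ‖w‖ ^ 2)) := by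
  rw [density, thetaModulus, mul_pow, mul_assoc, ← Real.exp_nat_mul, ← Real.exp_add, norm_mul,
    mul_pow, Complex.norm_real, Real.norm_eq_abs, sq_abs]
  congr 3
  push_cast
  ring

lemma differentiable_thetaSigma_comp_mul (s : ℝ) :
    Differentiable ℂ fun w : ℂ => thetaSigma (s * w) := by
  have := differentiable_thetaSigma
  fun_prop

lemma lintegral_density_thetaSigma_lt_top {s : ℝ} (hs : Real.pi * s ^ 2 < 1 / 2) :
    ∫⁻ w, density (fun w => thetaSigma (s * w)) w ∂area < ⊤ := by
  obtain ⟨B, hB⟩ := exists_thetaModulus_le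
  have hle (w : ℂ) : density (fun w => thetaSigma (s * w)) w ≤
      ENNReal.ofReal (B ^ 2 * Real.exp (-(1 / 2 - Real.pi * s ^ 2) * ‖w‖ ^ 2)) := by
    rw [density_thetaSigma_comp_mul]
    have := pow_le_pow_left₀ (thetaModulus_nonneg (s * w)) (hB (s * w)) 2
    gcongr
  refine (lintegral_mono hle).trans_lt ?_
  rw [area, lintegral_smul_measure, smul_eq_mul]
  refine ENNReal.mul_lt_top ENNReal.ofReal_lt_top (Integrable.lintegral_lt_top ?_)
  exact (integrable_exp_neg_mul_sq (by linarith)).const_mul _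

/-- The dilate `thetaSigma (s ·)`, as an element of the Fock space. -/
def thetaFock {s : ℝ} (hs : Real.pi * s ^ 2 < 1 / 2) : FockSpace :=
  ⟨fun w => thetaSigma (s * w), differentiable_thetaSigma_comp_mul s,
    (memLp_gaussian_iff (differentiable_thetaSigma_comp_mul s).continuous).2
      (lintegral_density_thetaSigma_lt_top hs)⟩

/-! ### Entire functions on separated families of points -/

/-- The weighted values of an entire function on a separated family are dominated by its weighted
area integral. -/
lemma tsum_density_le {ι : Type*} [Countable ι] {a : ι → ℂ} {ρ : ℝ} (hρ : 0 < ρ)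
    (ha : Pairwise fun i j => 2 * ρ ≤ dist (a i) (a j)) {f : ℂ → ℂ} (hf : Differentiable ℂ f) :
    ∑' i, density f (a i) ≤
      ENNReal.ofReal (Real.exp (ρ ^ 2 / 2) / ρ ^ 2) * ∫⁻ w, density f w ∂area := by
  have hdisj : Pairwise (Function.onFun Disjoint fun i => Metric.ball (a i) ρ) := by
    intro i j hij
    refine Metric.ball_disjoint_ball ?_
    linarith [ha hij]
  calc ∑' i, density f (a i)
      ≤ ∑' i, ENNReal.ofReal (Real.exp (ρ ^ 2 / 2) / ρ ^ 2) *
          ∫⁻ w in Metric.ball (a i) ρ, density f w ∂area :=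
        ENNReal.tsum_le_tsum fun i => density_le_setLIntegral hf hρ (a i)
    _ = ENNReal.ofReal (Real.exp (ρ ^ 2 / 2) / ρ ^ 2) *
          ∫⁻ w in ⋃ i, Metric.ball (a i) ρ, density f w ∂area := by
        rw [ENNReal.tsum_mul_left, lintegral_iUnion (fun i => measurableSet_ball) hdisj]
    _ ≤ _ := mul_le_mul_right (setLIntegral_le_lintegral _ _) _

/-- A nonzero entire function whose weighted modulus is periodic is not in the Fock space: the
weighted modulus takes one positive value along an infinite separated sequence. -/
lemma lintegral_density_eq_top_of_periodic {f : ℂ → ℂ} (hf : Differentiable ℂ f) {r : ℝ}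
    (hr : 0 < r) (hper : Function.Periodic (density f) (r : ℂ)) {p : ℂ} (hp : density f p ≠ 0) :
    ∫⁻ w, density f w ∂area = ⊤ := by
  by_contra htop
  have hsep : Pairwise fun i j : ℕ => 2 * (r / 2) ≤ dist (p + i * r) (p + j * (r : ℂ)) := by
    intro i j hij
    rw [dist_add_left, dist_eq_norm, ← sub_mul, norm_mul, Complex.norm_real,
      Real.norm_of_nonneg hr.le]
    have h : (1 : ℝ) ≤ ‖((i : ℂ) - j)‖ := by
      have h1 : (i : ℤ) - j ≠ 0 := by lia
      have h2 := Int.one_le_abs h1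
      have h3 : ((i : ℂ) - j) = (((i : ℤ) - j : ℤ) : ℂ) := by push_cast; rfl
      rw [h3, Complex.norm_intCast]
      exact_mod_cast h2
    nlinarith
  have h := tsum_density_le (half_pos hr) hsep hf
  have hc (i : ℕ) : density f (p + i * r) = density f p := hper.nat_mul i p
  simp only [hc] at h
  rw [ENNReal.tsum_const_eq_top_of_ne_zero hp, top_le_iff] at h
  exact ENNReal.mul_ne_top ENNReal.ofReal_ne_top htop h

/-! ### Dilates of the theta function on the critical lattice -/

lemma norm_gaussianInt_sq (m n : ℤ) : ‖(m + n * Complex.I : ℂ)‖ ^ 2 = (m : ℝ) ^ 2 + n ^ 2 := by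
  rw [Complex.sq_norm, Complex.normSq_apply]
  simp
  ring

lemma norm_gaussianInt_sub_ge {m n m' n' : ℤ} (h : ¬ (m = m' ∧ n = n')) :
    1 ≤ ‖((m + n * Complex.I) - (m' + n' * Complex.I) : ℂ)‖ := by
  have h1 : ((m + n * Complex.I) - (m' + n' * Complex.I) : ℂ) =
      ((m - m' : ℤ) + (n - n' : ℤ) * Complex.I : ℂ) := by
    push_cast
    ring
  rw [h1, ← one_le_sq_iff₀ (norm_nonneg _), norm_gaussianInt_sq]
  have h2 : 1 ≤ (m - m') ^ 2 + (n - n') ^ 2 := by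
    by_contra h3
    have h4 : (m - m') ^ 2 = 0 := by nlinarith [sq_nonneg (m - m'), sq_nonneg (n - n')]
    have h5 : (n - n') ^ 2 = 0 := by nlinarith [sq_nonneg (m - m'), sq_nonneg (n - n')]
    exact h ⟨by simpa [sub_eq_zero] using h4, by simpa [sub_eq_zero] using h5⟩
  exact_mod_cast h2

/-- Riemann sums of a Gaussian are bounded uniformly in the mesh. -/
lemma tsum_int_gaussian_le {δ : ℝ} (hδ : 0 < δ) (hδ1 : δ ≤ 1) :
    ∑' m : ℤ, ENNReal.ofReal (δ * Real.exp (-(δ ^ 2 * (m : ℝ) ^ 2) / 2)) ≤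
      ENNReal.ofReal (4 * Real.exp (1 / 2)) := by
  set q := Real.exp (-δ) with hq
  have hq1 : q < 1 := by simpa [hq] using hδ
  have hq0 : 0 < q := Real.exp_pos _
  have hqδ : q * (1 + δ) ≤ 1 := by
    have := Real.add_one_le_exp δ
    calc q * (1 + δ) ≤ q * Real.exp δ := by gcongr; linarith
      _ = 1 := by rw [hq, ← Real.exp_add]; simp
  -- completing the square bounds the Gaussian by a geometric sequence
  have hterm (x : ℝ) (n : ℕ) (hx : (n : ℝ) ≤ |x|) :
      δ * Real.exp (-(δ ^ 2 * x ^ 2) / 2) ≤ δ * Real.exp (1 / 2) * q ^ n := by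
    rw [mul_assoc, hq, ← Real.exp_nat_mul, ← Real.exp_add]
    gcongr
    rw [← sq_abs x]
    nlinarith [sq_nonneg (δ * |x| - 1)]
  have hgeom : ∑' n : ℕ, ENNReal.ofReal (δ * Real.exp (1 / 2) * q ^ n) ≤
      ENNReal.ofReal (2 * Real.exp (1 / 2)) := by
    rw [← ENNReal.ofReal_tsum_of_nonneg (fun n => by positivity)
      ((summable_geometric_of_lt_one hq0.le hq1).mul_left _), tsum_mul_left,
      tsum_geometric_of_lt_one hq0.le hq1]
    refine ENNReal.ofReal_le_ofReal ?_
    rw [← div_eq_mul_inv, div_le_iff₀ (by linarith)]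
    have h2 : δ ≤ 2 * (1 - q) := by nlinarith
    nlinarith [Real.exp_pos (1 / 2)]
  have h4 : ENNReal.ofReal (4 * Real.exp (1 / 2)) =
      ENNReal.ofReal (2 * Real.exp (1 / 2)) + ENNReal.ofReal (2 * Real.exp (1 / 2)) := by
    rw [← ENNReal.ofReal_add (by positivity) (by positivity)]
    ring_nf
  rw [h4, tsum_of_nat_of_neg_add_one ENNReal.summable ENNReal.summable]
  refine add_le_add ((ENNReal.tsum_le_tsum fun n => ?_).trans hgeom)
    ((ENNReal.tsum_le_tsum fun n => ?_).trans hgeom)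
  · refine ENNReal.ofReal_le_ofReal (hterm _ n ?_)
    simp
  · refine ENNReal.ofReal_le_ofReal (hterm _ n ?_)
    push_cast
    rw [abs_neg, abs_of_nonneg (by positivity)]
    linarith

lemma tsum_gaussianInt_gaussian_le {ε : ℝ} (hε : 0 < ε) (hε1 : ε ≤ 1) :
    ∑' p : ℤ × ℤ, ENNReal.ofReal (ε * Real.exp (-(ε * ((p.1 : ℝ) ^ 2 + p.2 ^ 2)) / 2)) ≤
      ENNReal.ofReal (4 * Real.exp (1 / 2)) * ENNReal.ofReal (4 * Real.exp (1 / 2)) := by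
  have hs : √ε ^ 2 = ε := Real.sq_sqrt hε.le
  have h1 := tsum_int_gaussian_le (Real.sqrt_pos.2 hε) (Real.sqrt_le_one.2 hε1)
  rw [hs] at h1
  refine le_trans (le_of_eq ?_) (mul_le_mul' h1 h1)
  rw [ENNReal.tsum_prod', ← ENNReal.tsum_mul_right]
  refine tsum_congr fun m => ?_
  rw [← ENNReal.tsum_mul_left]
  refine tsum_congr fun n => ?_
  rw [← ENNReal.ofReal_mul (by positivity), mul_mul_mul_comm, ← sq, hs, ← Real.exp_add]
  ring_nf

/-- At the critical density the dilates `thetaSigma (s ·)`, with `s = (1 - ε) / √(2π)`, have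
bounded weighted `ℓ²` norm on the lattice, although their Fock norms are unbounded: their value at
a lattice point `a` is that of the doubly periodic modulus at distance `ε |a| / √(2π)` from one of
its zeros, and is therefore `O(ε |a|)`. -/
lemma exists_tsum_density_thetaSigma_le :
    ∃ K : ENNReal, K ≠ ⊤ ∧ ∀ ε : ℝ, 0 < ε → ε ≤ 1 →
      ∑' p : ℤ × ℤ, density (fun w => thetaSigma (((1 - ε) / √(2 * Real.pi) : ℝ) * w))
        (√(2 * Real.pi) * (p.1 + p.2 * Complex.I)) ≤ K := by
  obtain ⟨C, hC⟩ := exists_thetaModulus_le_mul_norm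
  refine ⟨ENNReal.ofReal (2 * C ^ 2) *
    (ENNReal.ofReal (4 * Real.exp (1 / 2)) * ENNReal.ofReal (4 * Real.exp (1 / 2))),
    ENNReal.mul_ne_top ENNReal.ofReal_ne_top
      (ENNReal.mul_ne_top ENNReal.ofReal_ne_top ENNReal.ofReal_ne_top), fun ε hε hε1 => ?_⟩
  refine le_trans ?_ (mul_le_mul_right (tsum_gaussianInt_gaussian_le hε hε1) _)
  rw [← ENNReal.tsum_mul_left]
  refine ENNReal.tsum_le_tsum fun ⟨m, n⟩ => ?_
  set r := √(2 * Real.pi) with hr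
  have hr2 : r ^ 2 = 2 * Real.pi := Real.sq_sqrt (by positivity)
  have hrpos : 0 < r := Real.sqrt_pos.2 (by positivity)
  have hrC : (r : ℂ) ≠ 0 := by exact_mod_cast hrpos.ne'
  set N : ℝ := (m : ℝ) ^ 2 + n ^ 2 with hN
  have hN0 : 0 ≤ N := by positivity
  have harg : (((1 - ε) / r : ℝ) : ℂ) * (r * (m + n * Complex.I)) =
      -(ε : ℂ) * (m + n * Complex.I) + (m + n * Complex.I) := by
    push_cast
    field_simp
    ring
  have hmod : thetaModulus ((((1 - ε) / r : ℝ) : ℂ) * (r * (m + n * Complex.I))) ^ 2 ≤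
      C ^ 2 * (ε ^ 2 * N) := by
    rw [harg, thetaModulus_add_gaussianInt]
    have h := pow_le_pow_left₀ (thetaModulus_nonneg _) (hC (-(ε : ℂ) * (m + n * Complex.I))) 2
    rwa [norm_mul, norm_neg, Complex.norm_real, Real.norm_eq_abs, mul_pow, mul_pow, sq_abs,
      norm_gaussianInt_sq] at h
  -- the exponent is `-(1 - (1 - ε) ^ 2) π N = -ε (2 - ε) π N`, and `(2 - ε) π ≥ 1`
  have hexp : Real.exp (-(1 / 2 - Real.pi * ((1 - ε) / r) ^ 2) *
      ‖(r * (m + n * Complex.I) : ℂ)‖ ^ 2) ≤ Real.exp (-(ε * N)) := by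
    rw [norm_mul, mul_pow, norm_gaussianInt_sq, Complex.norm_real, Real.norm_eq_abs, sq_abs,
      div_pow, hr2]
    have h1 : -(1 / 2 - Real.pi * ((1 - ε) ^ 2 / (2 * Real.pi))) * (2 * Real.pi * N) =
        -(ε * N) * ((2 - ε) * Real.pi) := by
      have := Real.pi_pos.ne'
      field_simp
      ring
    rw [h1]
    refine Real.exp_le_exp.2 ?_
    have h2 : 1 ≤ (2 - ε) * Real.pi := by nlinarith [Real.pi_gt_three]
    nlinarith [mul_nonneg hε.le hN0]
  -- half of the exponential absorbs the factor `ε N`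
  have hsplit : ε * N * Real.exp (-(ε * N)) ≤ 2 * Real.exp (-(ε * N) / 2) := by
    have h1 := Real.add_one_le_exp (ε * N / 2)
    have h2 : Real.exp (-(ε * N)) = Real.exp (-(ε * N) / 2) * Real.exp (-(ε * N) / 2) := by
      rw [← Real.exp_add]
      ring_nf
    have h3 : Real.exp (ε * N / 2) * Real.exp (-(ε * N) / 2) = 1 := by
      rw [← Real.exp_add]
      ring_nf
      simp
    have h4 : ε * N * Real.exp (-(ε * N) / 2) ≤ 2 := by
      nlinarith [Real.exp_pos (-(ε * N) / 2)]
    rw [h2, ← mul_assoc]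
    gcongr
  rw [density_thetaSigma_comp_mul, ← ENNReal.ofReal_mul (by positivity)]
  refine ENNReal.ofReal_le_ofReal ?_
  calc _ ≤ C ^ 2 * (ε ^ 2 * N) * Real.exp (-(ε * N)) := by gcongr
    _ = C ^ 2 * ε * (ε * N * Real.exp (-(ε * N))) := by ring
    _ ≤ C ^ 2 * ε * (2 * Real.exp (-(ε * N) / 2)) := by gcongr
    _ = _ := by ring

lemma lintegral_density_thetaSigma_critical :
    ∫⁻ w, density (fun w => thetaSigma ((1 / √(2 * Real.pi) : ℝ) * w)) w ∂area = ⊤ := by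
  have hrpos : 0 < √(2 * Real.pi) := Real.sqrt_pos.2 (by positivity)
  have hr2 : √(2 * Real.pi) ^ 2 = 2 * Real.pi := Real.sq_sqrt (by positivity)
  set r := √(2 * Real.pi) with hr
  have hrC : (r : ℂ) ≠ 0 := by exact_mod_cast hrpos.ne'
  have hd (w : ℂ) : density (fun w => thetaSigma ((1 / r : ℝ) * w)) w =
      ENNReal.ofReal (thetaModulus ((1 / r : ℝ) * w) ^ 2) := by
    rw [density_thetaSigma_comp_mul]
    have h1 : -(1 / 2 - Real.pi * (1 / r) ^ 2) * ‖w‖ ^ 2 = 0 := by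
      rw [div_pow, hr2]
      have := Real.pi_pos.ne'
      field_simp
      ring
    rw [h1, Real.exp_zero, mul_one]
  refine lintegral_density_eq_top_of_periodic (differentiable_thetaSigma_comp_mul _) hrpos
    (p := r * -((1 + Complex.I) / 2)) ?_ ?_
  · intro w
    have h1 : ((1 / r : ℝ) : ℂ) * (w + r) = ((1 / r : ℝ) : ℂ) * w + 1 := by
      push_cast
      field_simp
    rw [hd, hd, h1, thetaModulus_add_one]
  · have h1 : ((1 / r : ℝ) : ℂ) * (r * -((1 + Complex.I) / 2)) = -((1 + Complex.I) / 2) := by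
      push_cast
      field_simp
    rw [hd, h1]
    have := (thetaModulus_nonneg (-((1 + Complex.I) / 2))).lt_of_ne' thetaModulus_ne_zero
    simp only [ne_eq, ENNReal.ofReal_eq_zero, not_le]
    positivity

lemma lintegral_density_thetaSigma_ne_zero {s : ℝ} (hs : s ≠ 0) :
    ∫⁻ w, density (fun w => thetaSigma (s * w)) w ∂area ≠ 0 := by
  intro h0
  have hcont := (differentiable_thetaSigma_comp_mul s).continuous
  have hsC : (s : ℂ) ≠ 0 := by exact_mod_cast hs
  set p : ℂ := (s : ℂ)⁻¹ * -((1 + Complex.I) / 2) with hp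
  have hpos : density (fun w => thetaSigma (s * w)) p ≠ 0 := by
    rw [density_thetaSigma_comp_mul, hp, mul_inv_cancel_left₀ hsC]
    have := (thetaModulus_nonneg (-((1 + Complex.I) / 2))).lt_of_ne' thetaModulus_ne_zero
    simp only [ne_eq, ENNReal.ofReal_eq_zero, not_le]
    positivity
  have h := density_le_setLIntegral (differentiable_thetaSigma_comp_mul s) one_pos p
  have h2 := h.trans (mul_le_mul_right (setLIntegral_le_lintegral _ _) _)
  rw [h0, mul_zero] at h2
  exact hpos (le_zero_iff.1 h2)

/-! ### The point masses on a square lattice -/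

section Lattice

variable {r : ℝ} {a : ℕ → ℂ}

/-- Injective integer coordinates of an enumeration of the square lattice. -/
lemma exists_coordinates (ha : Function.Injective a)
    (hrange : Set.range a = lattice 0 (r : ℂ) (Complex.I * (r : ℂ))) :
    ∃ c : ℕ → ℤ × ℤ, Function.Injective c ∧
      ∀ k, a k = r * ((c k).1 + (c k).2 * Complex.I) := by
  have h (k : ℕ) : ∃ p : ℤ × ℤ, a k = r * (p.1 + p.2 * Complex.I) := by
    have hk : a k ∈ lattice 0 (r : ℂ) (Complex.I * (r : ℂ)) := hrange ▸ Set.mem_range_self k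
    obtain ⟨m, n, hmn⟩ := hk
    refine ⟨(m, n), ?_⟩
    rw [hmn]
    ring
  choose c hc using h
  refine ⟨c, fun i j hij => ha ?_, hc⟩
  rw [hc, hc, hij]

lemma separated_enumeration (hr : 0 < r) (ha : Function.Injective a)
    (hrange : Set.range a = lattice 0 (r : ℂ) (Complex.I * (r : ℂ))) :
    Pairwise fun i j => 2 * (r / 2) ≤ dist (a i) (a j) := by
  obtain ⟨c, hc, hac⟩ := exists_coordinates ha hrange
  intro i j hij
  rw [hac, hac, dist_eq_norm, ← mul_sub, norm_mul, Complex.norm_real, Real.norm_of_nonneg hr.le]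
  have h := norm_gaussianInt_sub_ge (m := (c i).1) (n := (c i).2) (m' := (c j).1) (n' := (c j).2)
    fun h => hij (hc (Prod.ext h.1 h.2))
  nlinarith

lemma exists_dist_enumeration_lt (hr : 0 < r)
    (hrange : Set.range a = lattice 0 (r : ℂ) (Complex.I * (r : ℂ))) (z : ℂ) :
    ∃ k, dist (a k) z < r := by
  have hrC : (r : ℂ) ≠ 0 := by exact_mod_cast hr.ne'
  obtain ⟨m, n, h⟩ := exists_gaussianInt_norm_sub_lt (z / r)
  have hmem : (r : ℂ) * (m + n * Complex.I) ∈ Set.range a := by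
    rw [hrange]
    exact ⟨m, n, by ring⟩
  obtain ⟨k, hk⟩ := hmem
  refine ⟨k, ?_⟩
  have h1 : z - r * (m + n * Complex.I) = r * (z / r - (m + n * Complex.I)) := by
    field_simp
  rw [hk, dist_comm, dist_eq_norm, h1, norm_mul, Complex.norm_real, Real.norm_of_nonneg hr.le]
  nlinarith

/-- The sum of unit point masses along a sequence; a point that is repeated counts with its
multiplicity. -/
def pointMasses (a : ℕ → ℂ) : Measure ℂ := Measure.sum fun k => Measure.dirac (a k)

lemma lintegral_pointMasses (F : ℂ → ENNReal) : ∫⁻ w, F w ∂pointMasses a = ∑' k, F (a k) := by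
  rw [pointMasses, lintegral_sum_measure]
  simp

lemma lintegral_density_pointMasses_le (hr : 0 < r) (ha : Function.Injective a)
    (hrange : Set.range a = lattice 0 (r : ℂ) (Complex.I * (r : ℂ))) {f : ℂ → ℂ}
    (hf : Differentiable ℂ f) :
    ∫⁻ w, density f w ∂pointMasses a ≤
      ENNReal.ofReal (Real.exp ((r / 2) ^ 2 / 2) / (r / 2) ^ 2) * ∫⁻ w, density f w ∂area := by
  rw [lintegral_pointMasses]
  exact tsum_density_le (half_pos hr) (separated_enumeration hr ha hrange) hf

lemma isCarleson_pointMasses (hr : 0 < r) (ha : Function.Injective a)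
    (hrange : Set.range a = lattice 0 (r : ℂ) (Complex.I * (r : ℂ))) :
    IsCarleson (pointMasses a) :=
  ⟨_, ENNReal.ofReal_ne_top, fun f => lintegral_density_pointMasses_le hr ha hrange f.2.1⟩

theorem IsCarleson.conditionM {μ : Measure ℂ} (hμ : IsCarleson μ) : ConditionM μ :=
  fun z => hμ.lintegral_lt_top (kernelFock z)

lemma normalizedKernel_eq_weyl (z : ℂ) : normalizedKernel z = weyl (-z) 1 := by
  ext w
  rw [normalizedKernel, weyl, norm_neg]
  simp [neg_div]

lemma density_normalizedKernel (z w : ℂ) :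
    density (normalizedKernel z) w = ENNReal.ofReal (Real.exp (-‖w - z‖ ^ 2 / 2)) := by
  rw [normalizedKernel_eq_weyl, density_weyl, density]
  simp [sub_eq_add_neg]

lemma differentiable_normalizedKernel (z : ℂ) : Differentiable ℂ (normalizedKernel z) := by
  unfold normalizedKernel
  fun_prop

lemma lintegral_density_normalizedKernel (z : ℂ) :
    ∫⁻ w, density (normalizedKernel z) w ∂area =
      ∫⁻ w, ENNReal.ofReal (Real.exp (-‖w‖ ^ 2 / 2)) ∂area := by
  simp only [density_normalizedKernel]
  exact lintegral_sub_right_eq_self (fun w => ENNReal.ofReal (Real.exp (-‖w‖ ^ 2 / 2))) z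

lemma lintegral_exp_area_lt_top :
    ∫⁻ w, ENNReal.ofReal (Real.exp (-‖w‖ ^ 2 / 2)) ∂area < ⊤ := by
  rw [area, lintegral_smul_measure, smul_eq_mul]
  exact ENNReal.mul_lt_top ENNReal.ofReal_lt_top integrable_exp_neg_sq.lintegral_lt_top

lemma exists_lintegral_normalizedKernel_le (hr : 0 < r) (ha : Function.Injective a)
    (hrange : Set.range a = lattice 0 (r : ℂ) (Complex.I * (r : ℂ))) :
    ∃ K : ENNReal, K ≠ ⊤ ∧
      ∀ z, ∫⁻ w, density (normalizedKernel z) w ∂pointMasses a ≤ K := by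
  refine ⟨ENNReal.ofReal (Real.exp ((r / 2) ^ 2 / 2) / (r / 2) ^ 2) *
    ∫⁻ w, ENNReal.ofReal (Real.exp (-‖w‖ ^ 2 / 2)) ∂area,
    ENNReal.mul_ne_top ENNReal.ofReal_ne_top lintegral_exp_area_lt_top.ne, fun z => ?_⟩
  rw [← lintegral_density_normalizedKernel z]
  exact lintegral_density_pointMasses_le hr ha hrange (differentiable_normalizedKernel z)

/-- On the ball `B(z, r)` the density of `k_z` is bounded below, which turns the uniform bound on
`∫ |k_z|² exp (-|w|² / 2) dν` into a bound on the number of lattice points in the ball. -/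
theorem reverseCarlesonCondition_pointMasses (hr : 0 < r) (ha : Function.Injective a)
    (hrange : Set.range a = lattice 0 (r : ℂ) (Complex.I * (r : ℂ))) :
    ReverseCarlesonCondition (pointMasses a) := by
  obtain ⟨K, hK, hle⟩ := exists_lintegral_normalizedKernel_le hr ha hrange
  set c : ENNReal := ENNReal.ofReal (Real.exp (-r ^ 2 / 2)) with hc
  have hc0 : c ≠ 0 := by simp [hc, Real.exp_pos]
  have hupper (z : ℂ) : pointMasses a (Metric.ball z r) ≤ K / c := by
    rw [ENNReal.le_div_iff_mul_le (Or.inl hc0) (Or.inl ENNReal.ofReal_ne_top), mul_comm]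
    refine le_trans ?_ (hle z)
    rw [← setLIntegral_const]
    refine (setLIntegral_mono' measurableSet_ball fun w hw => ?_).trans
      (setLIntegral_le_lintegral _ _)
    rw [density_normalizedKernel]
    have hw' : ‖w - z‖ < r := by simpa [dist_eq_norm] using hw
    refine ENNReal.ofReal_le_ofReal (Real.exp_le_exp.2 ?_)
    nlinarith [norm_nonneg (w - z)]
  have hKc : K / c ≠ ⊤ := ENNReal.div_ne_top hK hc0
  refine ⟨r, max 1 (K / c).toReal, hr, by positivity, fun z => ⟨?_, ?_⟩⟩
  · obtain ⟨k, hk⟩ := exists_dist_enumeration_lt hr hrange z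
    calc ENNReal.ofReal (max 1 (K / c).toReal)⁻¹ ≤ 1 := by
          rw [ENNReal.ofReal_le_one]
          exact inv_le_one_of_one_le₀ (le_max_left _ _)
      _ = Measure.dirac (a k) (Metric.ball z r) := by
          rw [Measure.dirac_apply_of_mem (Metric.mem_ball.2 hk)]
      _ ≤ ∑' k, Measure.dirac (a k) (Metric.ball z r) := ENNReal.le_tsum k
      _ ≤ _ := Measure.le_sum_apply _ _
  · refine (hupper z).trans ?_
    exact (ENNReal.ofReal_toReal hKc).symm.trans_le
      (ENNReal.ofReal_le_ofReal (le_max_right _ _))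

theorem exists_le_berezin_pointMasses (hr : 0 < r) (ha : Function.Injective a)
    (hrange : Set.range a = lattice 0 (r : ℂ) (Complex.I * (r : ℂ))) :
    ∃ δ : ℝ, 0 < δ ∧ ∀ z : ℂ, δ ≤ berezin (pointMasses a) z := by
  obtain ⟨K, hK, hle⟩ := exists_lintegral_normalizedKernel_le hr ha hrange
  refine ⟨1 / 2 * Real.exp (-r ^ 2 / 2), by positivity, fun z => ?_⟩
  have hcont : Continuous fun w => ‖normalizedKernel z w‖ ^ 2 * Real.exp (-‖w‖ ^ 2 / 2) := by
    have := (differentiable_normalizedKernel z).continuous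
    fun_prop
  rw [berezin, integral_eq_lintegral_of_nonneg_ae
    (Filter.Eventually.of_forall fun w => by positivity) hcont.aestronglyMeasurable]
  change _ ≤ 1 / 2 * (∫⁻ w, density (normalizedKernel z) w ∂pointMasses a).toReal
  gcongr
  rw [← ENNReal.ofReal_le_iff_le_toReal ((hle z).trans_lt hK.lt_top).ne, lintegral_pointMasses]
  obtain ⟨k, hk⟩ := exists_dist_enumeration_lt hr hrange z
  refine le_trans ?_ (ENNReal.le_tsum k)
  rw [density_normalizedKernel]
  rw [dist_eq_norm] at hk
  refine ENNReal.ofReal_le_ofReal (Real.exp_le_exp.2 ?_)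
  nlinarith [norm_nonneg (a k - z)]

/-- Below the critical density a dilate of `thetaSigma` in the Fock space vanishes on the lattice.
At the critical density the inequality, applied to the dilates `thetaSigma (s ·)` with
`s < 1 / √(2π)`, would bound their norms uniformly, and by Fatou's lemma
`thetaSigma (· / √(2π))` would be square integrable. -/
theorem not_isReverseCarleson_pointMasses (hr : √(2 * Real.pi) ≤ r) (ha : Function.Injective a)
    (hrange : Set.range a = lattice 0 (r : ℂ) (Complex.I * (r : ℂ))) :
    ¬ IsReverseCarleson (pointMasses a) := by
  rintro ⟨C, hC, h⟩
  replace h (f : FockSpace) : ENNReal.ofReal C * ∫⁻ w, density f w ∂area ≤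
      ∫⁻ w, density f w ∂pointMasses a := h f
  obtain ⟨c, hc, hac⟩ := exists_coordinates ha hrange
  have hr0 : 0 < √(2 * Real.pi) := Real.sqrt_pos.2 (by positivity)
  have hr2 : √(2 * Real.pi) ^ 2 = 2 * Real.pi := Real.sq_sqrt (by positivity)
  have hrpos : 0 < r := hr0.trans_le hr
  rcases hr.lt_or_eq with hlt | heq
  · have hs : Real.pi * (1 / r) ^ 2 < 1 / 2 := by
      have : 2 * Real.pi < r ^ 2 := by rw [← hr2]; gcongr
      rw [div_pow, one_pow, mul_one_div, div_lt_iff₀ (by positivity)]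
      linarith
    have h1 := h (thetaFock hs)
    have hval (k : ℕ) : density (thetaFock hs) (a k) = 0 := by
      change density (fun w => thetaSigma ((1 / r : ℝ) * w)) (a k) = 0
      have harg : ((1 / r : ℝ) : ℂ) * a k = 0 + ((c k).1 + (c k).2 * Complex.I) := by
        have hrC : (r : ℂ) ≠ 0 := by exact_mod_cast hrpos.ne'
        rw [hac]
        push_cast
        field_simp
        ring
      rw [density_thetaSigma_comp_mul, harg, thetaModulus_add_gaussianInt, thetaModulus,
        thetaSigma_zero]
      simp
    rw [lintegral_pointMasses] at h1
    simp only [hval, tsum_zero, nonpos_iff_eq_zero, mul_eq_zero, ENNReal.ofReal_eq_zero] at h1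
    exact h1.elim (not_le.2 hC)
      (lintegral_density_thetaSigma_ne_zero (one_div_ne_zero hrpos.ne'))
  · obtain ⟨K, hK, hle⟩ := exists_tsum_density_thetaSigma_le
    set ε : ℕ → ℝ := fun n => 1 / (n + 1) with hε
    have hεpos (n : ℕ) : 0 < ε n := by positivity
    have hε1 (n : ℕ) : ε n ≤ 1 := by
      rw [hε, div_le_one (by positivity)]
      linarith [(Nat.cast_nonneg n : (0 : ℝ) ≤ n)]
    set s : ℕ → ℝ := fun n => (1 - ε n) / √(2 * Real.pi) with hsdef
    have hs (n : ℕ) : Real.pi * s n ^ 2 < 1 / 2 := by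
      rw [hsdef, div_pow, hr2, ← mul_div_assoc, div_lt_iff₀ (by positivity)]
      have : (1 - ε n) ^ 2 < 1 := by nlinarith [hεpos n, hε1 n]
      nlinarith [Real.pi_pos]
    have hbound (n : ℕ) : ∫⁻ w, density (fun w => thetaSigma (s n * w)) w ∂area ≤
        K / ENNReal.ofReal C := by
      rw [ENNReal.le_div_iff_mul_le (Or.inl (by simpa using hC)) (Or.inl ENNReal.ofReal_ne_top),
        mul_comm]
      refine (h (thetaFock (hs n))).trans ?_
      rw [lintegral_pointMasses]
      refine le_trans ?_ (hle (ε n) (hεpos n) (hε1 n))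
      refine le_trans (le_of_eq (tsum_congr fun k => ?_))
        (ENNReal.tsum_comp_le_tsum_of_injective hc _)
      rw [hac, ← heq]
      rfl
    have hslim : Filter.Tendsto s Filter.atTop (nhds (1 / √(2 * Real.pi))) := by
      have h1 : Filter.Tendsto ε Filter.atTop (nhds 0) := tendsto_one_div_add_atTop_nhds_zero_nat
      have h2 := (h1.const_sub 1).div_const (√(2 * Real.pi))
      rwa [sub_zero] at h2
    have hpt (w : ℂ) : Filter.Tendsto (fun n => density (fun w => thetaSigma (s n * w)) w)
        Filter.atTop (nhds (density (fun w => thetaSigma ((1 / √(2 * Real.pi) : ℝ) * w)) w)) := by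
      have hcont : Continuous fun t : ℝ => density (fun w => thetaSigma (t * w)) w := by
        have := differentiable_thetaSigma.continuous
        unfold density
        exact ENNReal.continuous_ofReal.comp (by fun_prop)
      exact (hcont.tendsto _).comp hslim
    have hfatou := lintegral_liminf_le (μ := area) (u := Filter.atTop)
      (f := fun n w => density (fun w => thetaSigma (s n * w)) w)
      fun n => (continuous_density (differentiable_thetaSigma_comp_mul (s n)).continuous).measurable
    simp only [fun w => (hpt w).liminf_eq] at hfatou
    rw [lintegral_density_thetaSigma_critical, top_le_iff] at hfatou
    have hlim : Filter.liminf (fun n => ∫⁻ w, density (fun w => thetaSigma (s n * w)) w ∂area)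
        Filter.atTop ≤ K / ENNReal.ofReal C :=
      (Filter.liminf_le_liminf (Filter.Eventually.of_forall hbound)).trans_eq
        (Filter.liminf_const _)
    rw [hfatou, top_le_iff] at hlim
    exact ENNReal.div_ne_top hK (by simpa using hC) hlim

end Lattice

end Fock

end

theorem mainTheorem2 (r : ℝ) (hr : Real.sqrt (2 * Real.pi) ≤ r)
    (a : ℕ → ℂ) (ha : Function.Injective a)
    (hrange : Set.range a = Fock.lattice 0 (r : ℂ) (Complex.I * (r : ℂ)))
    (ν : MeasureTheory.Measure ℂ)
    (hν : ν = MeasureTheory.Measure.sum fun k => MeasureTheory.Measure.dirac (a k)) :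
    ¬ Fock.IsReverseCarleson ν ∧
    Fock.ConditionM ν ∧
    Fock.ReverseCarlesonCondition ν ∧
    (∃ δ : ℝ, 0 < δ ∧ ∀ z : ℂ, δ ≤ Fock.berezin ν z) ∧
    ∃ T : Fock.FockSpace →L[ℂ] Fock.FockSpace, Fock.IsToeplitz ν T ∧ ¬ IsUnit T := by
  have hrpos : 0 < r := (Real.sqrt_pos.2 (by positivity)).trans_le hr
  have hν' : ν = Fock.pointMasses a := hν
  subst hν'
  have hC := Fock.isCarleson_pointMasses hrpos ha hrange
  have hnot := Fock.not_isReverseCarleson_pointMasses hr ha hrange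
  exact ⟨hnot, hC.conditionM, Fock.reverseCarlesonCondition_pointMasses hrpos ha hrange,
    Fock.exists_le_berezin_pointMasses hrpos ha hrange,
    hC.toeplitz, hC.isToeplitz, fun hT => hnot (hC.isReverseCarleson hT)⟩
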